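/- For every $\delta\in(0,1)$ there is a constant $C>0$, depending only on $\delta$, such that the following holds. Let $Q\in\mathbb{R}^{m\times m}$ be (symmetric) positive definite, $r\in\mathbb{R}^m$, $L(z)=z^TQz-2r^Tz$ and $z^*=\arg\min_{z\in\mathbb{R}^m}L(z)$. Let $B>0$, let $K_A\ge 1$ be an integer, and let $0<\epsilon\le\|Q\|(1+\|z^*\|)^2$ (spectral norm for matrices, Euclidean norm for vectors). For each of the $m^2$ entries of $Q$ and each of the $m$ entries of $r$, let real random samples be given. All samples are independent, each has the corresponding entry $Q_{ij}$ or $r_i$ as its expectation, and each is at most $B$ in absolute value almost surely. A sample of an entry of $Q$ costs $K_A^2$ quantum measurements and a sample of an entry of $r$ costs $K_A$. For $N\in\mathbb{N}$ let $\hat Q_{ij}$ and $\hat r_i$ be the averages of $N$ samples of the respective entries, so that $M(N)=N(m^2K_A^2+mK_A)$ measurements are used in total. Put $$X=\frac{B^2K_A^2m^3\,\|Q\|\,\|Q^{-1}\|^2\,(1+\|z^*\|)^2}{\epsilon}.$$ If $M(N)\ge C X$, then with probability at least $1-\delta^m$ the estimated quadratic $\hat L(z)=z^T\hat Qz-2\hat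 r^Tz$ has a unique minimiser $\hat z$, and $$L(\hat z)-L(z^*)\le\epsilon .$$ Moreover, some $N$ satisfies $CX\le M(N)\le 2CX$. Hence $O\big(B^2K_A^2m^3\|Q\|\|Q^{-1}\|^2(1+\|z^*\|)^2/\epsilon\big)$ quantum measurements suffice. The same holds, with the same $C$, when $Q$, $r$ and the samples come from a linear system through Hadamard tests, as follows. Let $A=\sum_{k=1}^{K_A}\beta_kU_k$ with $\beta_k>0$ and unitaries $U_k$ on $n$ qubits, $|b\rangle=U_b|0^n\rangle$ and $|u_i\rangle=W_i|0^n\rangle$ for $i=1,\dots,m$, with $U_b$ and the $W_i$ unitary. Let $Q_{ij}=\mathrm{Re}\,\langle u_i|A^\dagger A|u_j\rangle$ be positive definite and $r_i=\mathrm{Re}\,\langle u_i|A^\dagger|b\rangle$. The Hadamard test for a unitary $V$ applies a Hadamard gate to the ancilla of $|0\rangle|0^n\rangle$, then $|0\rangle\langle0|\otimes 1+|1\rangle\langle1|\otimes V$, then a Hadamard gate to the ancilla, and measures $Z$ on the ancilla, with an outcome in $\{1,-1\}$ distributed by Born's rule. Each sample of $Q_{ij}$ is $\sum_{k,k'}\beta_k\beta_{k'}y_{kk'}$,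 where $y_{kk'}$ is the outcome of one test for $W_i^\dagger U_k^\dagger U_{k'}W_j$. Each sample of $r_i$ is $\sum_k\beta_ky_k$, where $y_k$ is the outcome of one test for $W_i^\dagger U_k^\dagger U_b$. All outcomes are independent, and all samples are at most $B$ in absolute value almost surely. -/

import Mathlib

open MeasureTheory ProbabilityTheory
open scoped Matrix Kronecker

noncomputable section

/-- The quadratic function `L(z) = zᵀ Q z - 2 rᵀ z`. -/
def quadLoss {m : ℕ} (Q : Matrix (Fin m) (Fin m) ℝ) (r : Fin m → ℝ) (z : Fin m → ℝ) : ℝ :=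
  z ⬝ᵥ (Q *ᵥ z) - 2 * (r ⬝ᵥ z)

/-- The spectral norm (operator norm for the Euclidean norm) of a real square matrix. -/
def specNorm {m : ℕ} (Q : Matrix (Fin m) (Fin m) ℝ) : ℝ :=
  ‖Matrix.toEuclideanCLM (n := Fin m) (𝕜 := ℝ) Q‖

/-- The Euclidean norm of a real vector. -/
def euclNorm {m : ℕ} (z : Fin m → ℝ) : ℝ := ‖(WithLp.toLp 2 z : EuclideanSpace ℝ (Fin m))‖

/-- The empirical mean of the first `N` samples. -/
def sampleMean {Ω : Type*} (N : ℕ) (X : ℕ → Ω → ℝ) (ω : Ω) : ℝ :=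
  (∑ s ∈ Finset.range N, X s ω) / N

/-- The estimated quadratic `zᵀ Q̂ z - 2 r̂ᵀ z` has a unique minimiser `ẑ`, and this minimiser is
`ε`-optimal for `zᵀ Q z - 2 rᵀ z`, whose minimiser is `zstar`. -/
def EstimateIsGood {m : ℕ} (Q : Matrix (Fin m) (Fin m) ℝ) (r zstar : Fin m → ℝ) (ε : ℝ)
    (Qhat : Matrix (Fin m) (Fin m) ℝ) (rhat : Fin m → ℝ) : Prop :=
  ∃ zhat : Fin m → ℝ, (∀ z, z ≠ zhat → quadLoss Qhat rhat zhat < quadLoss Qhat rhat z) ∧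
    quadLoss Q r zhat - quadLoss Q r zstar ≤ ε

/-- Total number of quantum measurements when `N` samples are taken of each of the `m²` entries of
`Q` (every sample uses `K²` measurements) and of each of the `m` entries of `r` (every sample uses
`K` measurements). -/
def numMeasurements (m K N : ℕ) : ℕ := N * (m ^ 2 * K ^ 2 + m * K)

/-- The quantity `B² K² m³ ‖Q‖ ‖Q⁻¹‖² (1 + ‖zstar‖)² / ε`. -/
def measurementBudget {m : ℕ} (B : ℝ) (K : ℕ) (Q : Matrix (Fin m) (Fin m) ℝ)
    (zstar : Fin m → ℝ) (ε : ℝ) : ℝ :=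
  B ^ 2 * (K : ℝ) ^ 2 * (m : ℝ) ^ 3 * specNorm Q * specNorm Q⁻¹ ^ 2 * (1 + euclNorm zstar) ^ 2 / ε

/-! ### The Hadamard test on `n` qubits -/

/-- Labels of the computational basis of `n` qubits. -/
abbrev Bits (n : ℕ) : Type := Fin n → Fin 2

/-- The state `|0ⁿ⟩`. -/
def zeroKet (n : ℕ) : Bits n → ℂ := Pi.single 0 1

/-- The one-qubit Hadamard gate. -/
def hadamardGate : Matrix (Fin 2) (Fin 2) ℂ := ((Real.sqrt 2 : ℂ)⁻¹) • !![1, 1; 1, -1]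

/-- The controlled gate `|0⟩⟨0| ⊗ 1 + |1⟩⟨1| ⊗ V`. -/
def controlledGate {n : ℕ} (V : Matrix (Bits n) (Bits n) ℂ) :
    Matrix (Fin 2 × Bits n) (Fin 2 × Bits n) ℂ :=
  Matrix.single 0 0 1 ⊗ₖ 1 + Matrix.single 1 1 1 ⊗ₖ V

/-- The state before the measurement in the Hadamard test for `V`: starting from `|0⟩|0ⁿ⟩`, apply a
Hadamard gate on the ancilla, the controlled gate, and a Hadamard gate on the ancilla. -/
def hadamardTestState {n : ℕ} (V : Matrix (Bits n) (Bits n) ℂ) : Fin 2 × Bits n → ℂ :=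
  ((hadamardGate ⊗ₖ 1) * controlledGate V * (hadamardGate ⊗ₖ 1)) *ᵥ Pi.single (0, 0) 1

/-- Born probability of finding the ancilla in the state `|a⟩`. -/
def hadamardTestProb {n : ℕ} (V : Matrix (Bits n) (Bits n) ℂ) (a : Fin 2) : ℝ :=
  ∑ x : Bits n, ‖hadamardTestState V (a, x)‖ ^ 2

/-- The law of the outcome of the measurement of Pauli `Z` on the ancilla: outcome `1` for `|0⟩`
and outcome `-1` for `|1⟩`. -/
def hadamardTestLaw {n : ℕ} (V : Matrix (Bits n) (Bits n) ℂ) : Measure ℝ :=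
  ENNReal.ofReal (hadamardTestProb V 0) • Measure.dirac (1 : ℝ) +
    ENNReal.ofReal (hadamardTestProb V 1) • Measure.dirac (-1 : ℝ)

/-- A linear system `A x = |b⟩` with `A = ∑ₖ βₖ Uₖ` a combination of `K` unitaries and
`|b⟩ = U_b |0ⁿ⟩`, together with circuits `W₁, …, W_m` preparing the subspace states
`|uᵢ⟩ = Wᵢ |0ⁿ⟩`. -/
structure SubspaceProblem (n K m : ℕ) where
  β : Fin K → ℝ
  β_pos : ∀ k, 0 < β k
  U : Fin K → Matrix.unitaryGroup (Bits n) ℂ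
  Ub : Matrix.unitaryGroup (Bits n) ℂ
  W : Fin m → Matrix.unitaryGroup (Bits n) ℂ

/-- The labels of the Hadamard tests in one round of sampling: for each entry `(i, j)` of `Q` one
test for each pair `(k, k')`, and for each entry `i` of `r` one test for each `k`. -/
abbrev TestIndex (m K : ℕ) : Type := (Fin m × Fin m × Fin K × Fin K) ⊕ (Fin m × Fin K)

theorem card_tests (m K N : ℕ) :
    Fintype.card (Fin N × TestIndex m K) = numMeasurements m K N := by
  simp only [Fintype.card_prod, Fintype.card_sum, Fintype.card_fin, numMeasurements]
  ring

namespace SubspaceProblem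

variable {n K m : ℕ} (S : SubspaceProblem n K m)

/-- The matrix `A = ∑ₖ βₖ Uₖ`. -/
def A : Matrix (Bits n) (Bits n) ℂ := ∑ k, (S.β k : ℂ) • (S.U k : Matrix (Bits n) (Bits n) ℂ)

/-- The right-hand side `|b⟩ = U_b |0ⁿ⟩`. -/
def b : Bits n → ℂ := (S.Ub : Matrix (Bits n) (Bits n) ℂ) *ᵥ zeroKet n

/-- The subspace states `|uᵢ⟩ = Wᵢ |0ⁿ⟩`. -/
def u (i : Fin m) : Bits n → ℂ := (S.W i : Matrix (Bits n) (Bits n) ℂ) *ᵥ zeroKet n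

/-- `Q i j = Re ⟨uᵢ| A† A |uⱼ⟩`. -/
def Q : Matrix (Fin m) (Fin m) ℝ :=
  Matrix.of fun i j => (star (S.u i) ⬝ᵥ ((S.Aᴴ * S.A) *ᵥ S.u j)).re

/-- `r i = Re ⟨uᵢ| A† |b⟩`. -/
def r : Fin m → ℝ := fun i => (star (S.u i) ⬝ᵥ (S.Aᴴ *ᵥ S.b)).re

/-- The unitary that is controlled in each Hadamard test: `Wᵢ† Uₖ† Uₖ' Wⱼ` for `Q i j`, and
`Wᵢ† Uₖ† U_b` for `r i`. -/
def testUnitary : TestIndex m K → Matrix (Bits n) (Bits n) ℂ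
  | Sum.inl (i, j, k, k') =>
      (S.W i : Matrix (Bits n) (Bits n) ℂ)ᴴ * (S.U k : Matrix (Bits n) (Bits n) ℂ)ᴴ *
        (S.U k' : Matrix (Bits n) (Bits n) ℂ) * (S.W j : Matrix (Bits n) (Bits n) ℂ)
  | Sum.inr (i, k) =>
      (S.W i : Matrix (Bits n) (Bits n) ℂ)ᴴ * (S.U k : Matrix (Bits n) (Bits n) ℂ)ᴴ *
        (S.Ub : Matrix (Bits n) (Bits n) ℂ)

variable {Ω : Type*}

/-- A single sample of `Q i j`, computed from one round of Hadamard test outcomes `y`. -/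
def sampleQ (y : TestIndex m K → Ω → ℝ) (i j : Fin m) (ω : Ω) : ℝ :=
  ∑ k, ∑ k', S.β k * S.β k' * y (Sum.inl (i, j, k, k')) ω

/-- A single sample of `r i`, computed from one round of Hadamard test outcomes `y`. -/
def sampleR (y : TestIndex m K → Ω → ℝ) (i : Fin m) (ω : Ω) : ℝ :=
  ∑ k, S.β k * y (Sum.inr (i, k)) ω

end SubspaceProblem

end

/-!
The argument is deterministic perturbation theory plus a covering argument.

*Perturbation.* Let `E` be the error of the estimated matrix and `e` that of the estimated vector.
Only the symmetric part `S` of the estimated matrix matters for the estimated quadratic, and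
`S - Q` is no larger than `E`. If `‖E‖, ‖e‖ ≤ η` with `2 η ‖Q⁻¹‖ ≤ 1`, then `S` is still positive
definite, since the smallest eigenvalue of `Q` is at least `1 / ‖Q⁻¹‖`. The displacement
`d = zhat - zstar` solves `S d = e - (S - Q) zstar`, so `‖d‖ ≤ 2 ‖Q⁻¹‖ η (1 + ‖zstar‖)`, and the
excess loss is `dᵀ Q d ≤ ‖Q‖ ‖d‖²`. Hence `η² = ε / (4 ‖Q‖ ‖Q⁻¹‖² (1 + ‖zstar‖)²)` is good enough
(`estimateIsGood_of_close`), and the upper bound on `ε` is what gives `2 η ‖Q⁻¹‖ ≤ 1`.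

*Concentration.* For vectors `x`, `y` of the unit ball, `xᵀ E y` is a weighted sum of independent
centred bounded variables, so by Hoeffding's lemma it is sub-Gaussian with variance proxy `B² / N`.
The unit ball has a `1/2`-net with at most `5 ^ m` points (`exists_net`), and `‖E‖` is at most four
times the maximum of `|xᵀ E y|` over the net. A union bound over `25 ^ m` pairs of points
(`exists_measureReal_compl_le`) leaves a failure probability `4 * 25 ^ m * exp (-N η² / (32 B²))`,
which is at most `δ ^ m` once `N η² / B²` exceeds a multiple of `m` depending on `δ`. The number of
measurements is at most `2 N m² K²`, and this is the stated budget.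

*Rounding.* Since `Q 0 0 ≤ B` we have `B ‖Q⁻¹‖ ≥ 1`, so the budget is at least `m² K²`, about the cost
of one round of samples; rounding up to full rounds at most doubles the cost.

*Hadamard tests.* The expected outcome of the test for `V` is `Re ⟨0ⁿ|V|0ⁿ⟩`
(`hadamardTestProb_sub`), so the samples are unbiased, and they are functions of disjoint blocks of
independent outcomes, hence independent (`ProbabilityTheory.iIndepFun.comp_fibers`). The linear
system is thus a special case of the first part.
-/

/-! ### Perturbation of the minimiser of a quadratic -/

section Perturbation

variable {m : ℕ}

theorem euclNorm_nonneg (x : Fin m → ℝ) : 0 ≤ euclNorm x := norm_nonneg _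

theorem specNorm_nonneg (M : Matrix (Fin m) (Fin m) ℝ) : 0 ≤ specNorm M := norm_nonneg _

theorem dotProduct_eq_inner (x y : Fin m → ℝ) :
    x ⬝ᵥ y = inner ℝ (WithLp.toLp 2 x : EuclideanSpace ℝ (Fin m)) (WithLp.toLp 2 y) := by
  simp [PiLp.inner_apply, dotProduct, mul_comm]

theorem euclNorm_sq (x : Fin m → ℝ) : euclNorm x ^ 2 = x ⬝ᵥ x := by
  rw [dotProduct_eq_inner, real_inner_self_eq_norm_sq, euclNorm]

theorem euclNorm_pos {x : Fin m → ℝ} (hx : x ≠ 0) : 0 < euclNorm x := by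
  rw [euclNorm, norm_pos_iff]
  simpa using hx

theorem euclNorm_mulVec_le (M : Matrix (Fin m) (Fin m) ℝ) (x : Fin m → ℝ) :
    euclNorm (M *ᵥ x) ≤ specNorm M * euclNorm x := by
  simpa [euclNorm, specNorm] using
    (Matrix.toEuclideanCLM (n := Fin m) (𝕜 := ℝ) M).le_opNorm (WithLp.toLp 2 x)

theorem abs_dotProduct_le (x y : Fin m → ℝ) : |x ⬝ᵥ y| ≤ euclNorm x * euclNorm y := by
  rw [dotProduct_eq_inner]
  exact abs_real_inner_le_norm _ _

theorem abs_dotProduct_mulVec_le (M : Matrix (Fin m) (Fin m) ℝ) (x y : Fin m → ℝ) :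
    |x ⬝ᵥ (M *ᵥ y)| ≤ specNorm M * (euclNorm x * euclNorm y) := by
  calc |x ⬝ᵥ (M *ᵥ y)| ≤ euclNorm x * euclNorm (M *ᵥ y) := abs_dotProduct_le _ _
    _ ≤ euclNorm x * (specNorm M * euclNorm y) := by
        gcongr
        · exact euclNorm_nonneg x
        · exact euclNorm_mulVec_le M y
    _ = _ := by ring

theorem dotProduct_mulVec_comm {S : Matrix (Fin m) (Fin m) ℝ} (hS : Sᵀ = S) (x y : Fin m → ℝ) :
    x ⬝ᵥ (S *ᵥ y) = y ⬝ᵥ (S *ᵥ x) := by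
  rw [Matrix.dotProduct_mulVec, ← Matrix.mulVec_transpose, hS, dotProduct_comm]

/-- Completing the square. -/
theorem quadLoss_eq_add {S : Matrix (Fin m) (Fin m) ℝ} (hS : Sᵀ = S) {r z₀ : Fin m → ℝ}
    (h₀ : S *ᵥ z₀ = r) (z : Fin m → ℝ) :
    quadLoss S r z = quadLoss S r z₀ + (z - z₀) ⬝ᵥ (S *ᵥ (z - z₀)) := by
  have h1 : z₀ ⬝ᵥ (S *ᵥ z) = z ⬝ᵥ r := by rw [dotProduct_mulVec_comm hS, h₀]
  simp only [quadLoss, Matrix.mulVec_sub, dotProduct_sub, sub_dotProduct, h₀, h1,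
    dotProduct_comm r]
  ring

theorem Matrix.PosDef.transpose_eq {Q : Matrix (Fin m) (Fin m) ℝ} (hQ : Q.PosDef) : Qᵀ = Q := by
  simpa [Matrix.IsHermitian, Matrix.conjTranspose_eq_transpose_of_trivial] using hQ.isHermitian

theorem Matrix.PosDef.dotProduct_mulVec_self_pos {Q : Matrix (Fin m) (Fin m) ℝ} (hQ : Q.PosDef)
    {x : Fin m → ℝ} (hx : x ≠ 0) : 0 < x ⬝ᵥ (Q *ᵥ x) := by
  simpa using hQ.dotProduct_mulVec_pos hx

theorem Matrix.PosDef.dotProduct_mulVec_self_nonneg {Q : Matrix (Fin m) (Fin m) ℝ} (hQ : Q.PosDef)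
    (x : Fin m → ℝ) : 0 ≤ x ⬝ᵥ (Q *ᵥ x) := by
  simpa using hQ.posSemidef.dotProduct_mulVec_nonneg x

theorem Matrix.PosDef.exists_mulVec_eq {Q : Matrix (Fin m) (Fin m) ℝ} (hQ : Q.PosDef)
    (r : Fin m → ℝ) : ∃ z, Q *ᵥ z = r := by
  refine ⟨Q⁻¹ *ᵥ r, ?_⟩
  rw [Matrix.mulVec_mulVec, Matrix.mul_nonsing_inv _ (Q.isUnit_iff_isUnit_det.1 hQ.isUnit),
    Matrix.one_mulVec]

/-- The minimiser of a positive definite quadratic solves the normal equations. -/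
theorem mulVec_eq_of_isMin {Q : Matrix (Fin m) (Fin m) ℝ} (hQ : Q.PosDef) {r zstar : Fin m → ℝ}
    (hz : ∀ z, quadLoss Q r zstar ≤ quadLoss Q r z) : Q *ᵥ zstar = r := by
  obtain ⟨z₀, h₀⟩ := hQ.exists_mulVec_eq r
  by_contra hne
  have h1 := quadLoss_eq_add hQ.transpose_eq h₀ zstar
  have h2 : zstar - z₀ ≠ 0 := by
    rw [sub_ne_zero]
    rintro rfl
    exact hne h₀
  have h3 := hQ.dotProduct_mulVec_self_pos h2
  linarith [hz z₀]

theorem specNorm_inv_pos [NeZero m] {Q : Matrix (Fin m) (Fin m) ℝ} (hQ : Q.PosDef) :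
    0 < specNorm Q⁻¹ := by
  refine norm_pos_iff.2 fun h => ?_
  rw [EmbeddingLike.map_eq_zero_iff] at h
  have := hQ.isUnit
  rw [← Matrix.isUnit_nonsing_inv_iff, h] at this
  exact not_isUnit_zero this

/-- The smallest eigenvalue of `Q` is at least `1 / ‖Q⁻¹‖`. -/
theorem euclNorm_sq_le [NeZero m] {Q : Matrix (Fin m) (Fin m) ℝ} (hQ : Q.PosDef) (v : Fin m → ℝ) :
    euclNorm v ^ 2 ≤ specNorm Q⁻¹ * (v ⬝ᵥ (Q *ᵥ v)) := by
  have hq := specNorm_inv_pos hQ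
  set q := specNorm Q⁻¹
  have hQQ : Q *ᵥ (Q⁻¹ *ᵥ v) = v := by
    rw [Matrix.mulVec_mulVec, Matrix.mul_nonsing_inv _ (Q.isUnit_iff_isUnit_det.1 hQ.isUnit),
      Matrix.one_mulVec]
  -- Cauchy-Schwarz for the form of `Q`, at `v` and `Q⁻¹ v`, as positivity of `v - q⁻¹ Q⁻¹ v`.
  have h1 := hQ.dotProduct_mulVec_self_nonneg (v - q⁻¹ • (Q⁻¹ *ᵥ v))
  have h2 : (Q⁻¹ *ᵥ v) ⬝ᵥ (Q *ᵥ v) = v ⬝ᵥ v := by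
    rw [dotProduct_mulVec_comm hQ.transpose_eq, hQQ]
  have h3 : v ⬝ᵥ (Q⁻¹ *ᵥ v) ≤ q * (v ⬝ᵥ v) := by
    rw [← euclNorm_sq]
    exact (le_abs_self _).trans ((abs_dotProduct_mulVec_le _ _ _).trans_eq (by ring))
  simp only [Matrix.mulVec_sub, Matrix.mulVec_smul, hQQ, dotProduct_sub, sub_dotProduct,
    smul_dotProduct, dotProduct_smul, h2, smul_eq_mul, dotProduct_comm (Q⁻¹ *ᵥ v) v] at h1
  rw [euclNorm_sq]
  have h4 : q⁻¹ * (q⁻¹ * (v ⬝ᵥ (Q⁻¹ *ᵥ v))) ≤ q⁻¹ * (v ⬝ᵥ v) := by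
    calc _ ≤ q⁻¹ * (q⁻¹ * (q * (v ⬝ᵥ v))) := by gcongr
      _ = _ := by field_simp
  have h5 : q⁻¹ * (v ⬝ᵥ v) ≤ v ⬝ᵥ (Q *ᵥ v) := by linarith
  calc v ⬝ᵥ v = q * (q⁻¹ * (v ⬝ᵥ v)) := by field_simp
    _ ≤ _ := by gcongr

/-- If `Q` and `r` are known up to an error `η` with `4 η² ‖Q‖ ‖Q⁻¹‖² (1 + ‖zstar‖)² ≤ ε`, then the
minimiser of the perturbed quadratic is `ε`-optimal. The perturbation of `Q` need not be symmetric;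
only its symmetric part matters. -/
theorem estimateIsGood_of_close [NeZero m] {Q Qhat : Matrix (Fin m) (Fin m) ℝ}
    {r rhat zstar : Fin m → ℝ} {ε η : ℝ} (hQ : Q.PosDef)
    (hz : ∀ z, quadLoss Q r zstar ≤ quadLoss Q r z) (hη : 0 ≤ η)
    (hηε : 4 * η ^ 2 * (specNorm Q * specNorm Q⁻¹ ^ 2 * (1 + euclNorm zstar) ^ 2) ≤ ε)
    (hηQ : 2 * η * specNorm Q⁻¹ ≤ 1)
    (hE : specNorm (Qhat - Q) ≤ η) (he : euclNorm (rhat - r) ≤ η) :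
    EstimateIsGood Q r zstar ε Qhat rhat := by
  have hq := specNorm_inv_pos hQ
  have hlow := euclNorm_sq_le hQ
  have hzr := mulVec_eq_of_isMin hQ hz
  set q := specNorm Q⁻¹
  set S : Matrix (Fin m) (Fin m) ℝ := (2⁻¹ : ℝ) • (Qhat + Qhatᵀ) with hSdef
  have hST : Sᵀ = S := by
    simp [hSdef, Matrix.transpose_smul, Matrix.transpose_add, add_comm]
  have htr : ∀ x y : Fin m → ℝ, x ⬝ᵥ (Qhatᵀ *ᵥ y) = y ⬝ᵥ (Qhat *ᵥ x) := fun x y => by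
    rw [Matrix.mulVec_transpose, dotProduct_comm, ← Matrix.dotProduct_mulVec]
  have hSxy : ∀ x y : Fin m → ℝ,
      x ⬝ᵥ (S *ᵥ y) = 2⁻¹ * (x ⬝ᵥ (Qhat *ᵥ y) + y ⬝ᵥ (Qhat *ᵥ x)) := fun x y => by
    simp only [hSdef, Matrix.smul_mulVec, Matrix.add_mulVec, dotProduct_smul, dotProduct_add, htr,
      smul_eq_mul]
  have hEx : ∀ x y : Fin m → ℝ, |x ⬝ᵥ (Qhat *ᵥ y) - x ⬝ᵥ (Q *ᵥ y)| ≤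
      η * (euclNorm x * euclNorm y) := fun x y => by
    rw [← dotProduct_sub, ← Matrix.sub_mulVec]
    refine (abs_dotProduct_mulVec_le _ _ _).trans ?_
    gcongr
    exact mul_nonneg (euclNorm_nonneg _) (euclNorm_nonneg _)
  have hSE : ∀ x y : Fin m → ℝ, |x ⬝ᵥ (S *ᵥ y) - x ⬝ᵥ (Q *ᵥ y)| ≤
      η * (euclNorm x * euclNorm y) := fun x y => by
    have h1 := abs_le.1 (hEx x y)
    have h2 := abs_le.1 (hEx y x)
    rw [hSxy, abs_le]
    have h3 := dotProduct_mulVec_comm hQ.transpose_eq x y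
    constructor <;> nlinarith
  have hSpos : ∀ x : Fin m → ℝ, x ≠ 0 → 0 < x ⬝ᵥ (S *ᵥ x) := fun x hx => by
    have h1 := (abs_le.1 (hSE x x)).1
    have h2 := hlow x
    have h3 := euclNorm_pos hx
    have h4 : 0 < x ⬝ᵥ (Q *ᵥ x) := hQ.dotProduct_mulVec_self_pos hx
    have h5 : 2 * η * euclNorm x ^ 2 ≤ x ⬝ᵥ (Q *ᵥ x) := by
      calc 2 * η * euclNorm x ^ 2 ≤ 2 * η * (q * (x ⬝ᵥ (Q *ᵥ x))) := by gcongr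
        _ = (2 * η * q) * (x ⬝ᵥ (Q *ᵥ x)) := by ring
        _ ≤ 1 * (x ⬝ᵥ (Q *ᵥ x)) := by gcongr
        _ = _ := one_mul _
    nlinarith
  have hSPD : S.PosDef := by
    refine Matrix.PosDef.of_dotProduct_mulVec_pos ?_ fun x hx => by simpa using hSpos x hx
    rw [Matrix.IsHermitian, Matrix.conjTranspose_eq_transpose_of_trivial, hST]
  obtain ⟨zhat, hzhat⟩ := hSPD.exists_mulVec_eq rhat
  have hloss : ∀ z, quadLoss Qhat rhat z = quadLoss S rhat z := fun z => by
    simp only [quadLoss, hSxy]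
    ring
  refine ⟨zhat, fun z hz => ?_, ?_⟩
  · rw [hloss, hloss, quadLoss_eq_add hST hzhat z]
    linarith [hSpos (z - zhat) (sub_ne_zero.2 hz)]
  · set d := zhat - zstar with hd
    rw [quadLoss_eq_add hQ.transpose_eq hzr zhat, add_sub_cancel_left]
    -- `d` solves `S d = (rhat - r) - (S - Q) zstar`.
    have hSd : d ⬝ᵥ (S *ᵥ d) = d ⬝ᵥ (rhat - r) - (d ⬝ᵥ (S *ᵥ zstar) - d ⬝ᵥ (Q *ᵥ zstar)) := by
      have : S *ᵥ d = rhat - S *ᵥ zstar := by rw [hd, Matrix.mulVec_sub, hzhat]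
      rw [this, hzr]
      simp only [dotProduct_sub]
      ring
    have h1 := (abs_le.1 (hSE d d)).1
    have h2 := (abs_le.1 (hSE d zstar)).1
    have h3 : d ⬝ᵥ (rhat - r) ≤ euclNorm d * η :=
      (le_abs_self _).trans ((abs_dotProduct_le _ _).trans (by
        gcongr
        exact euclNorm_nonneg _))
    have hdn := euclNorm_nonneg d
    have h4 := hlow d
    have h5 : d ⬝ᵥ (Q *ᵥ d) ≤ η * euclNorm d ^ 2 + η * (1 + euclNorm zstar) * euclNorm d := by
      nlinarith
    have h6 : euclNorm d ≤ 2 * q * η * (1 + euclNorm zstar) := by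
      rcases hdn.eq_or_lt with h0 | hpos
      · rw [← h0]
        have := euclNorm_nonneg zstar
        positivity
      have h7 : euclNorm d ^ 2 ≤
          q * (η * euclNorm d ^ 2 + η * (1 + euclNorm zstar) * euclNorm d) :=
        h4.trans (by gcongr)
      have h8 : 2 * η * q * euclNorm d ^ 2 ≤ 1 * euclNorm d ^ 2 := by gcongr
      refine le_of_mul_le_mul_right ?_ hpos
      nlinarith
    calc d ⬝ᵥ (Q *ᵥ d) ≤ specNorm Q * (euclNorm d * euclNorm d) :=
          (le_abs_self _).trans (abs_dotProduct_mulVec_le _ _ _)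
      _ = specNorm Q * euclNorm d ^ 2 := by ring
      _ ≤ specNorm Q * (2 * q * η * (1 + euclNorm zstar)) ^ 2 := by
          gcongr
          exact specNorm_nonneg _
      _ = 4 * η ^ 2 * (specNorm Q * q ^ 2 * (1 + euclNorm zstar) ^ 2) := by ring
      _ ≤ ε := hηε

end Perturbation

/-! ### Nets of the unit ball -/

section Net

/-- A maximal `1/2`-separated subset of the unit ball is a `1/2`-net, and has at most `5 ^ dim E`
elements by a volume argument. -/
theorem exists_net (E : Type*) [NormedAddCommGroup E] [NormedSpace ℝ E] [FiniteDimensional ℝ E] :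
    ∃ T : Finset E, T.card ≤ 5 ^ Module.finrank ℝ E ∧ (∀ t ∈ T, ‖t‖ ≤ 1) ∧
      ∀ v : E, ‖v‖ ≤ 1 → ∃ t ∈ T, ‖v - t‖ ≤ 1 / 2 := by
  classical
  let P : Finset E → Prop := fun T =>
    (∀ t ∈ T, ‖t‖ ≤ 1) ∧ ∀ c ∈ T, ∀ d ∈ T, c ≠ d → 1 / 2 ≤ ‖c - d‖
  have hcard : ∀ T, P T → T.card ≤ 5 ^ Module.finrank ℝ E := fun T hT => by
    have hinj : Function.Injective fun x : E => (2 : ℝ) • x := smul_right_injective E two_ne_zero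
    rw [← Finset.card_image_of_injective T hinj]
    refine Besicovitch.card_le_of_separated _ ?_ ?_
    · simp only [Finset.mem_image, forall_exists_index, and_imp, forall_apply_eq_imp_iff₂,
        norm_smul, Real.norm_ofNat]
      intro t ht
      linarith [hT.1 t ht]
    · simp only [Finset.mem_image, forall_exists_index, and_imp, forall_apply_eq_imp_iff₂,
        ← smul_sub, norm_smul, Real.norm_ofNat]
      intro c hc d hd hne
      have := hT.2 c hc d hd (fun h => hne (by rw [h]))
      linarith
  let A : Set ℕ := {k | ∃ T, P T ∧ T.card = k}
  have hA : A.Nonempty := ⟨0, ∅, by simp [P]⟩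
  have hbdd : BddAbove A := ⟨5 ^ Module.finrank ℝ E, by
    rintro k ⟨T, hT, rfl⟩
    exact hcard T hT⟩
  obtain ⟨T, hT, hTk⟩ := Nat.sSup_mem hA hbdd
  refine ⟨T, hcard T hT, hT.1, fun v hv => ?_⟩
  by_contra! hfar
  have hvT : v ∉ T := fun h => by
    have := hfar v h
    norm_num at this
  have hins : P (insert v T) := by
    refine ⟨?_, ?_⟩
    · simpa [hv] using hT.1
    · intro c hc d hd hne
      rcases Finset.mem_insert.1 hc with h | h <;> rcases Finset.mem_insert.1 hd with h' | h'
      · exact absurd (h.trans h'.symm) hne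
      · exact h ▸ (hfar d h').le
      · rw [norm_sub_rev]
        exact h' ▸ (hfar c h).le
      · exact hT.2 c h d h' hne
  have := le_csSup hbdd (show _ ∈ A from ⟨_, hins, rfl⟩)
  rw [← hTk, Finset.card_insert_of_notMem hvT] at this
  omega

/-- The operator norm is at most twice the maximum over a `1/2`-net of the unit ball. -/
theorem opNorm_le_two_mul_of_net {E F : Type*} [NormedAddCommGroup E] [NormedSpace ℝ E]
    [NormedAddCommGroup F] [NormedSpace ℝ F]
    {T : Finset E} (hT : ∀ v : E, ‖v‖ ≤ 1 → ∃ t ∈ T, ‖v - t‖ ≤ 1 / 2) (A : E →L[ℝ] F) {c : ℝ}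
    (h : ∀ t ∈ T, ‖A t‖ ≤ c) : ‖A‖ ≤ 2 * c := by
  have hc : 0 ≤ c := by
    obtain ⟨t, ht, -⟩ := hT 0 (by simp)
    exact (norm_nonneg _).trans (h t ht)
  have key : ‖A‖ ≤ c + ‖A‖ / 2 := by
    refine A.opNorm_le_of_unit_norm (by positivity) fun v hv => ?_
    obtain ⟨t, ht, htv⟩ := hT v hv.le
    calc ‖A v‖ = ‖A t + A (v - t)‖ := by rw [← map_add]; simp
      _ ≤ ‖A t‖ + ‖A (v - t)‖ := norm_add_le _ _
      _ ≤ c + ‖A‖ * (1 / 2) := by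
          gcongr
          · exact h t ht
          · exact (A.le_opNorm _).trans (by gcongr)
      _ = _ := by ring
  linarith

theorem norm_le_two_mul_of_net {E : Type*} [NormedAddCommGroup E] [InnerProductSpace ℝ E]
    {T : Finset E} (hT : ∀ v : E, ‖v‖ ≤ 1 → ∃ t ∈ T, ‖v - t‖ ≤ 1 / 2) (w : E) {c : ℝ}
    (h : ∀ t ∈ T, |inner ℝ t w| ≤ c) : ‖w‖ ≤ 2 * c := by
  rw [← innerSL_apply_norm ℝ w]
  refine opNorm_le_two_mul_of_net hT _ fun t ht => ?_
  rw [innerSL_apply_apply, real_inner_comm]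
  exact h t ht

theorem specNorm_le_four_mul_of_net {m : ℕ} {T : Finset (EuclideanSpace ℝ (Fin m))}
    (hT : ∀ v : EuclideanSpace ℝ (Fin m), ‖v‖ ≤ 1 → ∃ t ∈ T, ‖v - t‖ ≤ 1 / 2)
    (M : Matrix (Fin m) (Fin m) ℝ) {c : ℝ}
    (h : ∀ s ∈ T, ∀ t ∈ T, |s.ofLp ⬝ᵥ (M *ᵥ t.ofLp)| ≤ c) : specNorm M ≤ 4 * c := by
  have h1 : specNorm M ≤ 2 * (2 * c) := by
    refine opNorm_le_two_mul_of_net hT _ fun t ht => norm_le_two_mul_of_net hT _ fun s hs => ?_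
    rw [Matrix.inner_toEuclideanCLM]
    exact h s hs t ht
  linarith

theorem euclNorm_le_two_mul_of_net {m : ℕ} {T : Finset (EuclideanSpace ℝ (Fin m))}
    (hT : ∀ v : EuclideanSpace ℝ (Fin m), ‖v‖ ≤ 1 → ∃ t ∈ T, ‖v - t‖ ≤ 1 / 2)
    (x : Fin m → ℝ) {c : ℝ} (h : ∀ t ∈ T, |t.ofLp ⬝ᵥ x| ≤ c) : euclNorm x ≤ 2 * c := by
  refine norm_le_two_mul_of_net hT _ fun t ht => ?_
  have h1 := h t ht
  rwa [dotProduct_eq_inner] at h1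

end Net

/-! ### Concentration of the sample means -/

section Concentration

variable {Ω : Type*} {mΩ : MeasurableSpace Ω} {μ : Measure Ω}

theorem ProbabilityTheory.HasSubgaussianMGF.mono {X : Ω → ℝ} {c d : NNReal}
    (h : HasSubgaussianMGF X c μ) (hcd : c ≤ d) : HasSubgaussianMGF X d μ where
  integrable_exp_mul := h.integrable_exp_mul
  mgf_le t := (h.mgf_le t).trans (by gcongr)

/-- Hoeffding's inequality, two-sided and with weights. -/
theorem measureReal_le_abs_sum_le [IsProbabilityMeasure μ] {κ : Type*} {X : κ → Ω → ℝ} {B : ℝ}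
    (hX : ∀ k, AEMeasurable (X k) μ) (hind : iIndepFun X μ) (hB : ∀ k, ∀ᵐ ω ∂μ, |X k ω| ≤ B)
    (S : Finset κ) (a : κ → ℝ) {V : ℝ} (hV : B ^ 2 * ∑ k ∈ S, a k ^ 2 ≤ V) {t : ℝ}
    (ht : 0 ≤ t) :
    μ.real {ω | t ≤ |∑ k ∈ S, a k * (X k ω - ∫ x, X k x ∂μ)|} ≤
      2 * Real.exp (-t ^ 2 / (2 * V)) := by
  lift V to NNReal using le_trans (by positivity) hV
  set Z : κ → Ω → ℝ := fun k ω => a k * (X k ω - ∫ x, X k x ∂μ) with hZ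
  have hsub : ∀ k, HasSubgaussianMGF (Z k) (‖a k‖₊ ^ 2 * ‖B‖₊ ^ 2) μ := fun k => by
    refine ((hasSubgaussianMGF_of_mem_Icc (hX k) (a := -B) (b := B) (by
      filter_upwards [hB k] with ω hω using abs_le.1 hω)).const_mul (a k)).mono ?_
    rw [← NNReal.coe_le_coe]
    change a k ^ 2 * (‖B - -B‖ / 2) ^ 2 ≤ ‖a k‖ ^ 2 * ‖B‖ ^ 2
    rw [sub_neg_eq_add, ← two_mul, norm_mul, Real.norm_ofNat, mul_div_cancel_left₀ _ two_ne_zero,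
      Real.norm_eq_abs (a k), sq_abs]
  have hZind : iIndepFun Z μ :=
    hind.comp (fun (k : κ) (x : ℝ) => a k * (x - ∫ ω, X k ω ∂μ)) fun k => by fun_prop
  have hsum : HasSubgaussianMGF (fun ω => ∑ k ∈ S, Z k ω) V μ := by
    refine (HasSubgaussianMGF.sum_of_iIndepFun hZind fun k _ => hsub k).mono ?_
    rw [← NNReal.coe_le_coe]
    refine le_of_eq_of_le ?_ hV
    simp [Finset.mul_sum, mul_comm]
  have h1 := hsum.measure_ge_le ht
  have h2 := hsum.neg.measure_ge_le ht
  have hsplit : {ω | t ≤ |∑ k ∈ S, Z k ω|} ⊆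
      {ω | t ≤ ∑ k ∈ S, Z k ω} ∪ {ω | t ≤ (-fun ω => ∑ k ∈ S, Z k ω) ω} := fun ω hω => by
    simp only [Set.mem_union, Set.mem_ofPred_eq, Pi.neg_apply] at hω ⊢
    exact le_abs.1 hω
  calc _ ≤ _ := measureReal_mono hsplit
    _ ≤ _ := measureReal_union_le _ _
    _ ≤ _ := by linarith

theorem sampleMean_sub_eq {N : ℕ} (hN : N ≠ 0) (X : ℕ → Ω → ℝ) (c : ℝ) (ω : Ω) :
    sampleMean N X ω - c = ∑ s ∈ Finset.range N, (N : ℝ)⁻¹ * (X s ω - c) := by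
  have : (N : ℝ) ≠ 0 := by exact_mod_cast hN
  rw [← Finset.mul_sum, Finset.sum_sub_distrib, sampleMean]
  simp
  field_simp

/-- A linear combination of sample means, with coefficient vector in the unit ball, has
sub-Gaussian deviations of variance proxy `B² / N`. -/
theorem measureReal_le_abs_sum_sampleMean_le [IsProbabilityMeasure μ] {ι : Type*} [Fintype ι]
    {X : ℕ × ι → Ω → ℝ} {B : ℝ} (hX : ∀ k, AEMeasurable (X k) μ) (hind : iIndepFun X μ)
    (hB : ∀ k, ∀ᵐ ω ∂μ, |X k ω| ≤ B) {M : ι → ℝ} (hM : ∀ s p, ∫ ω, X (s, p) ω ∂μ = M p)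
    {a : ι → ℝ} (ha : ∑ p, a p ^ 2 ≤ 1) {N : ℕ} (hN : N ≠ 0) {t : ℝ} (ht : 0 ≤ t) :
    μ.real {ω | t ≤ |∑ p, a p * (sampleMean N (fun s => X (s, p)) ω - M p)|} ≤
      2 * Real.exp (-(N * t ^ 2 / (2 * B ^ 2))) := by
  have hN' : (0 : ℝ) < N := by exact_mod_cast hN.bot_lt
  have h := measureReal_le_abs_sum_le hX hind hB (Finset.range N ×ˢ Finset.univ)
    (fun k => (N : ℝ)⁻¹ * a k.2) (V := B ^ 2 / N) ?_ ht
  · refine le_of_eq_of_le ?_ (h.trans_eq ?_)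
    · congr 1
      ext ω
      simp only [Set.mem_ofPred_eq]
      rw [Finset.sum_product_right]
      simp only [sampleMean_sub_eq hN, hM, Finset.mul_sum]
      simp only [mul_left_comm, mul_assoc]
    · congr 2
      by_cases hB0 : B = 0
      · simp [hB0]
      · field_simp
  · rw [Finset.sum_product]
    simp only [mul_pow, ← Finset.mul_sum, Finset.sum_const, Finset.card_range, nsmul_eq_mul]
    calc B ^ 2 * ((N : ℝ)⁻¹ ^ 2 * (N * ∑ p, a p ^ 2))
        ≤ B ^ 2 * ((N : ℝ)⁻¹ ^ 2 * (N * 1)) := by gcongr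
      _ = B ^ 2 / N := by field_simp

theorem sum_sq_mul_le_one {m : ℕ} {s t : EuclideanSpace ℝ (Fin m)} (hs : ‖s‖ ≤ 1)
    (ht : ‖t‖ ≤ 1) : ∑ p : Fin m × Fin m, (s p.1 * t p.2) ^ 2 ≤ 1 := by
  have h : ∑ p : Fin m × Fin m, (s p.1 * t p.2) ^ 2 = ‖s‖ ^ 2 * ‖t‖ ^ 2 := by
    simp only [EuclideanSpace.real_norm_sq_eq, Finset.sum_mul_sum, Fintype.sum_prod_type, mul_pow]
  rw [h]
  exact mul_le_one₀ (pow_le_one₀ (norm_nonneg _) hs) (by positivity)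
    (pow_le_one₀ (norm_nonneg _) ht)

/-- With high probability the sample means of the coefficients have error at most `η` in spectral
and Euclidean norm: a union bound over the pairs of points of a net, for the bilinear form of the
error matrix, and over the points of the net, for the error vector. -/
theorem exists_measureReal_compl_le [IsProbabilityMeasure μ] {m : ℕ}
    {X : ℕ × ((Fin m × Fin m) ⊕ Fin m) → Ω → ℝ} {B : ℝ}
    (hX : ∀ k, AEMeasurable (X k) μ) (hind : iIndepFun X μ) (hB : ∀ k, ∀ᵐ ω ∂μ, |X k ω| ≤ B)
    {Q : Matrix (Fin m) (Fin m) ℝ} {r : Fin m → ℝ}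
    (hQ : ∀ s i j, ∫ ω, X (s, Sum.inl (i, j)) ω ∂μ = Q i j)
    (hr : ∀ s i, ∫ ω, X (s, Sum.inr i) ω ∂μ = r i)
    {N : ℕ} (hN : N ≠ 0) {η : ℝ} (hη : 0 ≤ η) :
    ∃ bad : Set Ω, μ.real bad ≤ 4 * 25 ^ m * Real.exp (-(N * η ^ 2 / (32 * B ^ 2))) ∧
      ∀ ω ∉ bad,
        specNorm ((Matrix.of fun i j => sampleMean N (fun s => X (s, Sum.inl (i, j))) ω) - Q) ≤ η ∧
        euclNorm ((fun i => sampleMean N (fun s => X (s, Sum.inr i)) ω) - r) ≤ η := by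
  obtain ⟨T, hcard, hT1, hT⟩ := exists_net (EuclideanSpace ℝ (Fin m))
  rw [finrank_euclideanSpace_fin] at hcard
  set M : (Fin m × Fin m) ⊕ Fin m → ℝ := Sum.elim (fun p => Q p.1 p.2) r with hMdef
  have hM : ∀ s p, ∫ ω, X (s, p) ω ∂μ = M p := by
    rintro s (⟨i, j⟩ | i)
    · exact hQ s i j
    · exact hr s i
  -- The threshold is `η / 4` because passing from the net to the spectral norm costs a factor `4`.
  let dev : ((Fin m × Fin m) ⊕ Fin m → ℝ) → Set Ω := fun a =>
    {ω | η / 4 ≤ |∑ p, a p * (sampleMean N (fun s => X (s, p)) ω - M p)|}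
  let aQ : EuclideanSpace ℝ (Fin m) × EuclideanSpace ℝ (Fin m) → (Fin m × Fin m) ⊕ Fin m → ℝ :=
    fun st => Sum.elim (fun p => st.1 p.1 * st.2 p.2) 0
  let ar : EuclideanSpace ℝ (Fin m) → (Fin m × Fin m) ⊕ Fin m → ℝ := fun t => Sum.elim 0 t.ofLp
  set e := Real.exp (-(N * η ^ 2 / (32 * B ^ 2))) with he
  have hdev : ∀ a : (Fin m × Fin m) ⊕ Fin m → ℝ, ∑ p, a p ^ 2 ≤ 1 → μ.real (dev a) ≤ 2 * e :=
    fun a ha => (measureReal_le_abs_sum_sampleMean_le hX hind hB hM ha hN (by positivity)).trans_eq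
      (by
        rw [he]
        congr 3
        ring)
  refine ⟨(⋃ st ∈ T ×ˢ T, dev (aQ st)) ∪ ⋃ t ∈ T, dev (ar t), ?_, fun ω hω => ?_⟩
  · have hc : (T.card : ℝ) ≤ 5 ^ m := by exact_mod_cast hcard
    have h1 : μ.real (⋃ st ∈ T ×ˢ T, dev (aQ st)) ≤ 25 ^ m * (2 * e) := by
      calc _ ≤ ∑ st ∈ T ×ˢ T, μ.real (dev (aQ st)) := measureReal_biUnion_finset_le _ _
        _ ≤ ∑ st ∈ T ×ˢ T, 2 * e := Finset.sum_le_sum fun st hst => hdev _ (by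
            rw [Finset.mem_product] at hst
            simpa [aQ] using sum_sq_mul_le_one (hT1 _ hst.1) (hT1 _ hst.2))
        _ = T.card * T.card * (2 * e) := by simp [Finset.card_product]
        _ ≤ 5 ^ m * 5 ^ m * (2 * e) := by gcongr
        _ = _ := by rw [← mul_pow]; norm_num
    have h2 : μ.real (⋃ t ∈ T, dev (ar t)) ≤ 25 ^ m * (2 * e) := by
      calc _ ≤ ∑ t ∈ T, μ.real (dev (ar t)) := measureReal_biUnion_finset_le _ _
        _ ≤ ∑ t ∈ T, 2 * e := Finset.sum_le_sum fun t ht => hdev _ (by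
            have := pow_le_one₀ (n := 2) (norm_nonneg _) (hT1 _ ht)
            rw [EuclideanSpace.real_norm_sq_eq] at this
            simpa [ar] using this)
        _ = T.card * (2 * e) := by simp
        _ ≤ 5 ^ m * (2 * e) := by gcongr
        _ ≤ 25 ^ m * (2 * e) := by gcongr; norm_num
    calc _ ≤ _ := measureReal_union_le _ _
      _ ≤ 25 ^ m * (2 * e) + 25 ^ m * (2 * e) := add_le_add h1 h2
      _ = _ := by ring
  · simp only [Set.mem_union, Set.mem_iUnion, not_or, not_exists] at hω
    refine ⟨?_, ?_⟩
    · refine (specNorm_le_four_mul_of_net hT (c := η / 4) _ fun s hs t ht => ?_).trans_eq (by ring)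
      have h := hω.1 (s, t) (Finset.mk_mem_product hs ht)
      simp only [dev, Set.mem_ofPred_eq, not_le] at h
      refine le_of_eq_of_le ?_ h.le
      congr 1
      simp only [aQ, hMdef, Fintype.sum_sum_type, Sum.elim_inl, Sum.elim_inr, Pi.zero_apply,
        zero_mul, Finset.sum_const_zero, add_zero, Fintype.sum_prod_type, dotProduct,
        Matrix.mulVec, Matrix.sub_apply, Matrix.of_apply, Finset.mul_sum]
      refine Finset.sum_congr rfl fun i _ => Finset.sum_congr rfl fun j _ => ?_
      ring
    · refine (euclNorm_le_two_mul_of_net hT (c := η / 4) _ fun t ht => ?_).trans (by linarith)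
      have h := hω.2 t ht
      simp only [dev, Set.mem_ofPred_eq, not_le] at h
      refine le_of_eq_of_le ?_ h.le
      simp [ar, hMdef, dotProduct]

end Concentration

/-! ### The number of measurements -/

section Budget

variable {Ω : Type*} {mΩ : MeasurableSpace Ω} {μ : Measure Ω} {m : ℕ}

/-- The constant of the measurement bound: it makes the failure probability
`4 * 25 ^ m * exp (-x)` of the union bound, where `4 * 25 ^ m ≤ 100 ^ m`, at most `δ ^ m`. -/
noncomputable def budgetConst (δ : ℝ) : ℝ := 256 * Real.log (100 / δ)

theorem two_le_budgetConst {δ : ℝ} (hδ0 : 0 < δ) (hδ1 : δ < 1) : 2 ≤ budgetConst δ := by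
  have h1 : Real.exp 1 ≤ 100 / δ := by
    rw [le_div_iff₀ hδ0]
    nlinarith [Real.exp_one_lt_d9, Real.exp_pos 1]
  have h2 := (Real.le_log_iff_exp_le (by positivity)).2 h1
  rw [budgetConst]
  linarith

theorem neZero_of_le_specNorm_mul {Q : Matrix (Fin m) (Fin m) ℝ} {ε c : ℝ} (hε : 0 < ε)
    (hεQ : ε ≤ specNorm Q * c) : NeZero m := by
  refine ⟨?_⟩
  rintro rfl
  have : specNorm Q = 0 := by
    rw [specNorm, Subsingleton.elim Q 0, map_zero, norm_zero]
  rw [this, zero_mul] at hεQ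
  exact hεQ.not_gt hε

theorem numMeasurements_le (m K N : ℕ) :
    (numMeasurements m K N : ℝ) ≤ N * (2 * (m ^ 2 * K ^ 2)) := by
  have h : m * K ≤ (m * K) ^ 2 := Nat.le_self_pow two_ne_zero _
  have : numMeasurements m K N ≤ N * (2 * (m ^ 2 * K ^ 2)) := by
    rw [numMeasurements]
    gcongr
    rw [mul_pow] at h
    omega
  exact_mod_cast this

/-- Since a diagonal entry of `Q` is at most `B`, so is `‖Q⁻¹‖⁻¹`. -/
theorem one_le_specNorm_inv_mul [NeZero m] {Q : Matrix (Fin m) (Fin m) ℝ} (hQ : Q.PosDef) {B : ℝ}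
    (hB : Q 0 0 ≤ B) : 1 ≤ specNorm Q⁻¹ * B := by
  have h := euclNorm_sq_le hQ (Pi.single 0 1)
  rw [euclNorm_sq] at h
  simp only [Matrix.mulVec_single_one, single_one_dotProduct, Pi.single_eq_same,
    Matrix.col_apply] at h
  exact h.trans (mul_le_mul_of_nonneg_left hB (specNorm_nonneg _))

/-- The budget is at least half the cost of one round of samples, so that rounding up to a whole
number of rounds at most doubles the cost. -/
theorem exists_numMeasurements {K : ℕ} [NeZero m] (hK : 1 ≤ K) {Q : Matrix (Fin m) (Fin m) ℝ}
    (hQ : Q.PosDef) {zstar : Fin m → ℝ} {B ε C : ℝ} (hB : Q 0 0 ≤ B) (hε : 0 < ε)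
    (hεQ : ε ≤ specNorm Q * (1 + euclNorm zstar) ^ 2) (hC : 2 ≤ C) :
    ∃ N : ℕ, C * measurementBudget B K Q zstar ε ≤ (numMeasurements m K N : ℝ) ∧
      (numMeasurements m K N : ℝ) ≤ 2 * (C * measurementBudget B K Q zstar ε) := by
  have hm : (1 : ℝ) ≤ m := by exact_mod_cast (NeZero.one_le : 1 ≤ m)
  have hbudget : (m : ℝ) ^ 2 * K ^ 2 ≤ measurementBudget B K Q zstar ε := by
    have h1 := one_le_specNorm_inv_mul hQ hB
    have h2 : 1 ≤ specNorm Q * (1 + euclNorm zstar) ^ 2 / ε := by rwa [one_le_div hε]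
    calc (m : ℝ) ^ 2 * K ^ 2 = K ^ 2 * m ^ 2 * 1 ^ 2 * 1 := by ring
      _ ≤ K ^ 2 * m ^ 3 * (specNorm Q⁻¹ * B) ^ 2 *
          (specNorm Q * (1 + euclNorm zstar) ^ 2 / ε) := by
        gcongr
        · norm_num
      _ = _ := by rw [measurementBudget]; ring
  set Y := measurementBudget B K Q zstar ε
  have hround : (numMeasurements m K 1 : ℝ) ≤ C * Y := by
    have h := numMeasurements_le m K 1
    have hY : 0 ≤ Y := le_trans (by positivity) hbudget
    calc _ ≤ _ := h
      _ = 2 * ((m : ℝ) ^ 2 * K ^ 2) := by simp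
      _ ≤ C * Y := by gcongr
  have hmul : ∀ N, (numMeasurements m K N : ℝ) = N * numMeasurements m K 1 := fun N => by
    simp [numMeasurements]
  have hpos : (0 : ℝ) < numMeasurements m K 1 := by
    have : 0 < numMeasurements m K 1 := by
      have := NeZero.pos m
      rw [numMeasurements]
      positivity
    exact_mod_cast this
  refine ⟨⌈C * Y / numMeasurements m K 1⌉₊, ?_, ?_⟩
  · rw [hmul, ← div_le_iff₀ hpos]
    exact Nat.le_ceil _
  · rw [hmul]
    have h := (Nat.ceil_lt_add_one (div_nonneg (hpos.le.trans hround) hpos.le)).le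
    calc _ ≤ (C * Y / numMeasurements m K 1 + 1) * numMeasurements m K 1 := by gcongr
      _ = C * Y + numMeasurements m K 1 := by field_simp
      _ ≤ _ := by linarith

theorem four_mul_pow_mul_exp_le {δ : ℝ} (hδ0 : 0 < δ) [NeZero m] {x : ℝ}
    (hx : m * Real.log (100 / δ) ≤ x) : 4 * 25 ^ m * Real.exp (-x) ≤ δ ^ m := by
  have hm : m ≠ 0 := NeZero.ne m
  calc 4 * 25 ^ m * Real.exp (-x) ≤ 4 ^ m * 25 ^ m * Real.exp (-(m * Real.log (100 / δ))) := by
        gcongr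
        exact le_self_pow₀ (by norm_num) hm
    _ = 100 ^ m * (100 / δ)⁻¹ ^ m := by
        rw [← mul_pow, ← mul_neg, ← Real.log_inv, Real.exp_nat_mul,
          Real.exp_log (by positivity)]
        norm_num
    _ = δ ^ m := by
        rw [← mul_pow]
        field_simp

/-- Independent unbiased bounded samples determine the minimiser of a positive definite quadratic
within the measurement budget. -/
theorem estimateIsGood_of_samples [IsProbabilityMeasure μ] {δ : ℝ} (hδ0 : 0 < δ) (hδ1 : δ < 1)
    {K : ℕ} (hK : 1 ≤ K) {Q : Matrix (Fin m) (Fin m) ℝ} {r zstar : Fin m → ℝ} {B ε : ℝ}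
    {X : ℕ × ((Fin m × Fin m) ⊕ Fin m) → Ω → ℝ} (hQ : Q.PosDef)
    (hz : ∀ z, quadLoss Q r zstar ≤ quadLoss Q r z) (hB : 0 < B) (hε : 0 < ε)
    (hεQ : ε ≤ specNorm Q * (1 + euclNorm zstar) ^ 2) (hX : ∀ p, AEMeasurable (X p) μ)
    (hind : iIndepFun X μ) (hXB : ∀ p, ∀ᵐ ω ∂μ, |X p ω| ≤ B)
    (hXQ : ∀ s i j, ∫ ω, X (s, Sum.inl (i, j)) ω ∂μ = Q i j)
    (hXr : ∀ s i, ∫ ω, X (s, Sum.inr i) ω ∂μ = r i) :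
    (∀ N : ℕ, budgetConst δ * measurementBudget B K Q zstar ε ≤ (numMeasurements m K N : ℝ) →
      1 - δ ^ m ≤ μ.real {ω | EstimateIsGood Q r zstar ε
        (Matrix.of fun i j => sampleMean N (fun s => X (s, Sum.inl (i, j))) ω)
        (fun i => sampleMean N (fun s => X (s, Sum.inr i)) ω)}) ∧
    ∃ N : ℕ, budgetConst δ * measurementBudget B K Q zstar ε ≤ (numMeasurements m K N : ℝ) ∧
      (numMeasurements m K N : ℝ) ≤ 2 * (budgetConst δ * measurementBudget B K Q zstar ε) := by
  have := neZero_of_le_specNorm_mul hε hεQ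
  have hC := two_le_budgetConst hδ0 hδ1
  have hm : (0 : ℝ) < m := by exact_mod_cast NeZero.pos m
  have hK' : (0 : ℝ) < K := by exact_mod_cast hK
  refine ⟨fun N hN => ?_, exists_numMeasurements hK hQ ?_ hε hεQ hC⟩
  swap
  · rw [← hXQ 0 0 0]
    have h := norm_integral_le_of_norm_le_const (μ := μ)
      (f := X (0, Sum.inl (0, 0))) (C := B) (hXB _)
    rw [probReal_univ, mul_one] at h
    exact (le_abs_self _).trans h
  have hq := specNorm_inv_pos hQ
  have hz0 := euclNorm_nonneg zstar
  have hQpos : 0 < specNorm Q := by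
    by_contra! h
    have h0 : specNorm Q = 0 := h.antisymm (specNorm_nonneg _)
    rw [h0, zero_mul] at hεQ
    exact hεQ.not_gt hε
  set D := specNorm Q * specNorm Q⁻¹ ^ 2 * (1 + euclNorm zstar) ^ 2 with hD
  have hDpos : 0 < D := by positivity
  -- The largest error that the perturbation bound tolerates.
  set η := Real.sqrt (ε / (4 * D)) with hηdef
  have hη : 0 ≤ η := Real.sqrt_nonneg _
  have hηsq : η ^ 2 = ε / (4 * D) := Real.sq_sqrt (by positivity)
  have hηQ : 2 * η * specNorm Q⁻¹ ≤ 1 := by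
    refine abs_le_of_sq_le_sq' ?_ zero_le_one |>.2
    calc (2 * η * specNorm Q⁻¹) ^ 2 = 4 * η ^ 2 * specNorm Q⁻¹ ^ 2 := by ring
      _ = ε / (specNorm Q * (1 + euclNorm zstar) ^ 2) := by
          rw [hηsq, hD]
          field_simp
      _ ≤ 1 ^ 2 := by
          rw [one_pow, div_le_one (by positivity)]
          exact hεQ
  have hX0 : measurementBudget B K Q zstar ε = B ^ 2 * K ^ 2 * m ^ 3 * D / ε := by
    rw [measurementBudget, hD]
    ring
  have hN' : m * Real.log (100 / δ) ≤ N * η ^ 2 / (32 * B ^ 2) := by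
    have h := hN.trans (numMeasurements_le m K N)
    rw [hX0, budgetConst] at h
    rw [hηsq]
    have hc : 0 < ε / (256 * B ^ 2 * K ^ 2 * m ^ 2 * D) := by positivity
    calc m * Real.log (100 / δ)
        = 256 * Real.log (100 / δ) * (B ^ 2 * K ^ 2 * m ^ 3 * D / ε) *
          (ε / (256 * B ^ 2 * K ^ 2 * m ^ 2 * D)) := by field_simp
      _ ≤ N * (2 * (m ^ 2 * K ^ 2)) * (ε / (256 * B ^ 2 * K ^ 2 * m ^ 2 * D)) := by
          gcongr
      _ = _ := by
          field_simp
          ring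
  have hN0 : N ≠ 0 := by
    rintro rfl
    have : 0 < m * Real.log (100 / δ) := by
      have : 0 < budgetConst δ := by linarith
      rw [budgetConst] at this
      have : 0 < Real.log (100 / δ) := by linarith
      positivity
    simp only [Nat.cast_zero, zero_mul, zero_div] at hN'
    exact hN'.not_gt this
  obtain ⟨bad, hbad, hgood⟩ := exists_measureReal_compl_le hX hind hXB hXQ hXr hN0 hη
  set G := {ω | EstimateIsGood Q r zstar ε
        (Matrix.of fun i j => sampleMean N (fun s => X (s, Sum.inl (i, j))) ω)
        (fun i => sampleMean N (fun s => X (s, Sum.inr i)) ω)} with hG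
  have hcover : Set.univ ⊆ G ∪ bad := fun ω _ => by
    by_cases hω : ω ∈ bad
    · exact Or.inr hω
    · obtain ⟨h1, h2⟩ := hgood ω hω
      refine Or.inl (estimateIsGood_of_close hQ hz hη ?_ hηQ h1 h2)
      rw [← hD, hηsq]
      apply le_of_eq
      field_simp
  have h1 : (1 : ℝ) ≤ μ.real G + μ.real bad := by
    rw [← probReal_univ (μ := μ)]
    exact (measureReal_mono hcover).trans (measureReal_union_le _ _)
  have h2 := hbad.trans (four_mul_pow_mul_exp_le hδ0 hN')
  linarith

end Budget

/-! ### Functions of disjoint blocks of independent random variables -/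

section Blocks

variable {Ω : Type*} {mΩ : MeasurableSpace Ω} {μ : Measure Ω}

/-- The converse of `iIndepFun_uncurry`: the blocks of an independent family are independent. -/
theorem ProbabilityTheory.iIndepFun.curry {ι : Type*} {κ : ι → Type*}
    {Y : (i : ι) → κ i → Ω → ℝ} (hY : ∀ i j, Measurable (Y i j))
    (h : iIndepFun (fun (p : (i : ι) × κ i) ω => Y p.1 p.2 ω) μ) :
    iIndepFun (fun i ω j => Y i j ω) μ := by
  have := h.isProbabilityMeasure
  have : ∀ i j, IsProbabilityMeasure (μ.map (Y i j)) :=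
    fun i j => Measure.isProbabilityMeasure_map (hY i j).aemeasurable
  have hblock : ∀ i, μ.map (fun ω j => Y i j ω) = Measure.infinitePi fun j => μ.map (Y i j) :=
    fun i => (iIndepFun_iff_map_fun_eq_infinitePi_map (hY i)).1
      (h.precomp (g := fun j : κ i => (⟨i, j⟩ : (i : ι) × κ i)) sigma_mk_injective)
  have hcurry : (MeasurableEquiv.piCurry fun (i : ι) (_ : κ i) => ℝ) ∘
      (fun ω (p : (i : ι) × κ i) => Y p.1 p.2 ω) = fun ω i j => Y i j ω := by
    ext
    simp [Sigma.curry]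
  rw [iIndepFun_iff_map_fun_eq_infinitePi_map (by fun_prop)]
  simp only [hblock]
  rw [← hcurry, ← Measure.map_map (by fun_prop) (by fun_prop),
    (iIndepFun_iff_map_fun_eq_infinitePi_map (by fun_prop)).1 h,
    Measure.infinitePi_map_piCurry (fun i j => μ.map (Y i j))]

/-- Random variables that are measurable functions of disjoint blocks of an independent family are
independent. The blocks are the fibres of `g`. -/
theorem ProbabilityTheory.iIndepFun.comp_fibers {ι κ : Type*} [Countable κ] {Y : κ → Ω → ℝ}
    (hY : ∀ k, AEMeasurable (Y k) μ) (h : iIndepFun Y μ) (g : κ → ι)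
    (φ : (i : ι) → ({k // g k = i} → ℝ) → ℝ) (hφ : ∀ i, Measurable (φ i)) :
    iIndepFun (fun i ω => φ i fun k => Y k ω) μ := by
  have h' : iIndepFun (fun k => (hY k).mk (Y k)) μ := h.congr fun k => (hY k).ae_eq_mk
  have h'' := h'.precomp (Equiv.sigmaFiberEquiv g).injective
  have hc := (ProbabilityTheory.iIndepFun.curry
    (Y := fun i (k : {k // g k = i}) => (hY k).mk (Y k)) (fun i k => (hY k).measurable_mk) h'').comp
      φ hφ
  refine hc.congr fun i => ?_
  have hall : ∀ᵐ ω ∂μ, ∀ k, Y k ω = (hY k).mk (Y k) ω := ae_all_iff.2 fun k => (hY k).ae_eq_mk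
  filter_upwards [hall] with ω hω
  simp [hω]

end Blocks

/-! ### The outcome of a Hadamard test -/

section HadamardTest

variable {n : ℕ}

theorem hadamardTestState_apply (V : Matrix (Bits n) (Bits n) ℂ) (a : Fin 2) (x : Bits n) :
    hadamardTestState V (a, x) =
      2⁻¹ * (zeroKet n x + (-1) ^ (a : ℕ) * (V *ᵥ zeroKet n) x) := by
  have hsq : ((Real.sqrt 2 : ℂ)⁻¹) * ((Real.sqrt 2 : ℂ)⁻¹) = 2⁻¹ := by
    rw [← mul_inv, ← Complex.ofReal_mul, Real.mul_self_sqrt zero_le_two, Complex.ofReal_ofNat]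
  rw [← hsq]
  fin_cases a <;>
  simp [hadamardTestState, hadamardGate, controlledGate, Matrix.mul_apply, Fintype.sum_prod_type,
    Matrix.one_apply, zeroKet, Pi.single_apply, Matrix.single_apply] <;>
  split_ifs <;> ring

/-- The expected outcome of the Hadamard test for `V` is `Re ⟨0ⁿ|V|0ⁿ⟩`. -/
theorem hadamardTestProb_sub (V : Matrix (Bits n) (Bits n) ℂ) :
    hadamardTestProb V 0 - hadamardTestProb V 1 =
      (star (zeroKet n) ⬝ᵥ (V *ᵥ zeroKet n)).re := by
  simp only [hadamardTestProb, ← Finset.sum_sub_distrib, dotProduct, Complex.re_sum,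
    hadamardTestState_apply]
  refine Finset.sum_congr rfl fun x _ => ?_
  simp only [Complex.sq_norm, Complex.normSq_apply]
  simp
  ring

theorem hadamardTestProb_nonneg (V : Matrix (Bits n) (Bits n) ℂ) (a : Fin 2) :
    0 ≤ hadamardTestProb V a :=
  Finset.sum_nonneg fun _ _ => sq_nonneg _

theorem integrable_hadamardTestLaw (V : Matrix (Bits n) (Bits n) ℂ) :
    Integrable (fun x => x) (hadamardTestLaw V) :=
  ((integrable_dirac (by simp)).smul_measure ENNReal.ofReal_ne_top).add_measure
    ((integrable_dirac (by simp)).smul_measure ENNReal.ofReal_ne_top)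

theorem integral_hadamardTestLaw (V : Matrix (Bits n) (Bits n) ℂ) :
    ∫ x, x ∂hadamardTestLaw V = (star (zeroKet n) ⬝ᵥ (V *ᵥ zeroKet n)).re := by
  rw [← hadamardTestProb_sub, hadamardTestLaw, integral_add_measure, integral_smul_measure,
    integral_smul_measure, integral_dirac, integral_dirac,
    ENNReal.toReal_ofReal (hadamardTestProb_nonneg _ _),
    ENNReal.toReal_ofReal (hadamardTestProb_nonneg _ _)]
  · simp [sub_eq_add_neg]
  · exact (integrable_dirac (by simp)).smul_measure ENNReal.ofReal_ne_top
  · exact (integrable_dirac (by simp)).smul_measure ENNReal.ofReal_ne_top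

variable {Ω : Type*} {mΩ : MeasurableSpace Ω} {μ : Measure Ω}

theorem integrable_of_hasLaw_hadamardTestLaw {V : Matrix (Bits n) (Bits n) ℂ} {y : Ω → ℝ}
    (hy : HasLaw y (hadamardTestLaw V) μ) : Integrable y μ := by
  have h := integrable_hadamardTestLaw V
  rw [← hy.map_eq] at h
  exact h.comp_aemeasurable hy.aemeasurable

theorem integral_of_hasLaw_hadamardTestLaw {V : Matrix (Bits n) (Bits n) ℂ} {y : Ω → ℝ}
    (hy : HasLaw y (hadamardTestLaw V) μ) :
    ∫ ω, y ω ∂μ = (star (zeroKet n) ⬝ᵥ (V *ᵥ zeroKet n)).re := by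
  rw [hy.integral_eq, integral_hadamardTestLaw]

end HadamardTest

/-! ### Sampling the quadratic of a linear system -/

theorem star_mulVec_dotProduct {ι : Type*} [Fintype ι] (W M : Matrix ι ι ℂ) (v w : ι → ℂ) :
    star (W *ᵥ v) ⬝ᵥ (M *ᵥ w) = star v ⬝ᵥ ((Wᴴ * M) *ᵥ w) := by
  rw [Matrix.star_mulVec, ← Matrix.dotProduct_mulVec, Matrix.mulVec_mulVec]

namespace SubspaceProblem

variable {n K m : ℕ} (S : SubspaceProblem n K m)

theorem Q_apply_eq_sum (i j : Fin m) :
    S.Q i j = ∑ k, ∑ k', S.β k * S.β k' *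
      (star (zeroKet n) ⬝ᵥ (S.testUnitary (Sum.inl (i, j, k, k')) *ᵥ zeroKet n)).re := by
  simp only [Q, Matrix.of_apply, u]
  rw [star_mulVec_dotProduct, Matrix.mulVec_mulVec]
  simp only [A, Matrix.conjTranspose_sum, Matrix.conjTranspose_smul, Finset.sum_mul,
    Finset.mul_sum, Matrix.sum_mulVec, dotProduct_sum, Complex.re_sum, testUnitary, mul_assoc,
    Matrix.smul_mul, Matrix.mul_smul, Matrix.smul_mulVec, dotProduct_smul, smul_eq_mul]
  rw [Finset.sum_comm]
  refine Finset.sum_congr rfl fun k _ => Finset.sum_congr rfl fun k' _ => ?_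
  simp only [Complex.re_ofReal_mul, Complex.star_def, Complex.conj_ofReal]
  ring

theorem r_apply_eq_sum (i : Fin m) :
    S.r i = ∑ k, S.β k *
      (star (zeroKet n) ⬝ᵥ (S.testUnitary (Sum.inr (i, k)) *ᵥ zeroKet n)).re := by
  simp only [r, u, b]
  rw [star_mulVec_dotProduct, Matrix.mulVec_mulVec]
  simp only [A, Matrix.conjTranspose_sum, Matrix.conjTranspose_smul, Finset.sum_mul,
    Finset.mul_sum, Matrix.sum_mulVec, dotProduct_sum, Complex.re_sum, testUnitary, mul_assoc,
    Matrix.smul_mul, Matrix.mul_smul, Matrix.smul_mulVec, dotProduct_smul, smul_eq_mul]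
  simp

variable {Ω : Type*} {mΩ : MeasurableSpace Ω} {μ : Measure Ω}

/-- The samples of all the coefficients, `Sum.inl (i, j)` standing for `Q i j` and `Sum.inr i` for
`r i`, computed in each round from the test outcomes `y` of that round. -/
def samples (y : ℕ × TestIndex m K → Ω → ℝ) (p : ℕ × ((Fin m × Fin m) ⊕ Fin m)) : Ω → ℝ :=
  Sum.elim (fun e => S.sampleQ (fun t => y (p.1, t)) e.1 e.2)
    (fun i => S.sampleR (fun t => y (p.1, t)) i) p.2

/-- The coefficient that a test serves to estimate. -/
def entryOfTest : TestIndex m K → (Fin m × Fin m) ⊕ Fin m :=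
  Sum.map (fun t => (t.1, t.2.1)) Prod.fst

theorem aemeasurable_samples {y : ℕ × TestIndex m K → Ω → ℝ} (hy : ∀ q, AEMeasurable (y q) μ)
    (p : ℕ × ((Fin m × Fin m) ⊕ Fin m)) : AEMeasurable (S.samples y p) μ := by
  obtain ⟨s, ⟨i, j⟩ | i⟩ := p
  · change AEMeasurable (fun ω => ∑ k, ∑ k', S.β k * S.β k' * y (s, Sum.inl (i, j, k, k')) ω) μ
    exact Finset.aemeasurable_fun_sum _ fun k _ => Finset.aemeasurable_fun_sum _ fun k' _ =>
      (hy _).const_mul _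
  · change AEMeasurable (fun ω => ∑ k, S.β k * y (s, Sum.inr (i, k)) ω) μ
    exact Finset.aemeasurable_fun_sum _ fun k _ => (hy _).const_mul _

theorem iIndepFun_samples {y : ℕ × TestIndex m K → Ω → ℝ} (hy : ∀ q, AEMeasurable (y q) μ)
    (hind : iIndepFun y μ) : iIndepFun (S.samples y) μ := by
  let g : ℕ × TestIndex m K → ℕ × ((Fin m × Fin m) ⊕ Fin m) := Prod.map id entryOfTest
  let φ : (p : ℕ × ((Fin m × Fin m) ⊕ Fin m)) → ({q // g q = p} → ℝ) → ℝ
    | (s, Sum.inl (i, j)), v =>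
        ∑ k, ∑ k', S.β k * S.β k' * v ⟨(s, Sum.inl (i, j, k, k')), rfl⟩
    | (s, Sum.inr i), v => ∑ k, S.β k * v ⟨(s, Sum.inr (i, k)), rfl⟩
  have hφ : ∀ p, Measurable (φ p) := by
    rintro ⟨s, ⟨i, j⟩ | i⟩ <;> fun_prop
  refine (hind.comp_fibers hy g φ hφ).congr fun p => ?_
  obtain ⟨s, ⟨i, j⟩ | i⟩ := p <;> rfl

theorem integral_sampleQ {y : TestIndex m K → Ω → ℝ}
    (hy : ∀ t, HasLaw (y t) (hadamardTestLaw (S.testUnitary t)) μ) (i j : Fin m) :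
    ∫ ω, S.sampleQ y i j ω ∂μ = S.Q i j := by
  have hint := fun t => integrable_of_hasLaw_hadamardTestLaw (hy t)
  simp only [sampleQ]
  rw [integral_finsetSum _ fun k _ => integrable_finsetSum _ fun k' _ => (hint _).const_mul _,
    Q_apply_eq_sum]
  refine Finset.sum_congr rfl fun k _ => ?_
  rw [integral_finsetSum _ fun k' _ => (hint _).const_mul _]
  refine Finset.sum_congr rfl fun k' _ => ?_
  rw [integral_const_mul, integral_of_hasLaw_hadamardTestLaw (hy _)]

theorem integral_sampleR {y : TestIndex m K → Ω → ℝ}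
    (hy : ∀ t, HasLaw (y t) (hadamardTestLaw (S.testUnitary t)) μ) (i : Fin m) :
    ∫ ω, S.sampleR y i ω ∂μ = S.r i := by
  have hint := fun t => integrable_of_hasLaw_hadamardTestLaw (hy t)
  simp only [sampleR]
  rw [integral_finsetSum _ fun k _ => (hint _).const_mul _, r_apply_eq_sum]
  refine Finset.sum_congr rfl fun k _ => ?_
  rw [integral_const_mul, integral_of_hasLaw_hadamardTestLaw (hy _)]

theorem one_le_of_posDef [NeZero m] (hQ : S.Q.PosDef) : 1 ≤ K := by
  rcases Nat.eq_zero_or_pos K with rfl | h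
  · have h0 := S.Q_apply_eq_sum 0 0
    have := hQ.diag_pos (i := 0)
    simp only [Finset.univ_eq_empty, Finset.sum_empty] at h0
    exact absurd h0 this.ne'
  · exact h

end SubspaceProblem

theorem proposition5 (δ : ℝ) (hδ0 : 0 < δ) (hδ1 : δ < 1) :
    ∃ C : ℝ, 0 < C ∧
      -- An arbitrary quadratic, with independent unbiased bounded samples of its coefficients.
      (∀ (m K : ℕ) (_ : 1 ≤ K) (Q : Matrix (Fin m) (Fin m) ℝ) (r zstar : Fin m → ℝ) (B ε : ℝ)
          (Ω : Type*) (_ : MeasurableSpace Ω) (μ : Measure Ω) (_ : IsProbabilityMeasure μ)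
          (X : ℕ × ((Fin m × Fin m) ⊕ Fin m) → Ω → ℝ),
        Q.PosDef → (∀ z, quadLoss Q r zstar ≤ quadLoss Q r z) → 0 < B → 0 < ε →
        ε ≤ specNorm Q * (1 + euclNorm zstar) ^ 2 →
        (∀ p, AEMeasurable (X p) μ) → iIndepFun X μ →
        (∀ p, ∀ᵐ ω ∂μ, |X p ω| ≤ B) →
        (∀ s i j, ∫ ω, X (s, Sum.inl (i, j)) ω ∂μ = Q i j) →
        (∀ s i, ∫ ω, X (s, Sum.inr i) ω ∂μ = r i) →
        (∀ N : ℕ, C * measurementBudget B K Q zstar ε ≤ (numMeasurements m K N : ℝ) →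
          1 - δ ^ m ≤ μ.real {ω | EstimateIsGood Q r zstar ε
            (Matrix.of fun i j => sampleMean N (fun s => X (s, Sum.inl (i, j))) ω)
            (fun i => sampleMean N (fun s => X (s, Sum.inr i)) ω)}) ∧
        ∃ N : ℕ, C * measurementBudget B K Q zstar ε ≤ (numMeasurements m K N : ℝ) ∧
          (numMeasurements m K N : ℝ) ≤ 2 * (C * measurementBudget B K Q zstar ε)) ∧
      -- The quadratic of a linear system, sampled by Hadamard tests.
      (∀ (n m K : ℕ) (S : SubspaceProblem n K m) (zstar : Fin m → ℝ) (B ε : ℝ)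
          (Ω : Type*) (_ : MeasurableSpace Ω) (μ : Measure Ω) (_ : IsProbabilityMeasure μ)
          (y : ℕ × TestIndex m K → Ω → ℝ),
        S.Q.PosDef → (∀ z, quadLoss S.Q S.r zstar ≤ quadLoss S.Q S.r z) → 0 < B → 0 < ε →
        ε ≤ specNorm S.Q * (1 + euclNorm zstar) ^ 2 →
        iIndepFun y μ →
        (∀ s t, HasLaw (y (s, t)) (hadamardTestLaw (S.testUnitary t)) μ) →
        (∀ s i j, ∀ᵐ ω ∂μ, |S.sampleQ (fun t => y (s, t)) i j ω| ≤ B) →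
        (∀ s i, ∀ᵐ ω ∂μ, |S.sampleR (fun t => y (s, t)) i ω| ≤ B) →
        (∀ N : ℕ, C * measurementBudget B K S.Q zstar ε ≤ (numMeasurements m K N : ℝ) →
          1 - δ ^ m ≤ μ.real {ω | EstimateIsGood S.Q S.r zstar ε
            (Matrix.of fun i j => sampleMean N (fun s => S.sampleQ (fun t => y (s, t)) i j) ω)
            (fun i => sampleMean N (fun s => S.sampleR (fun t => y (s, t)) i) ω)}) ∧
        ∃ N : ℕ, C * measurementBudget B K S.Q zstar ε ≤ (numMeasurements m K N : ℝ) ∧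
          (numMeasurements m K N : ℝ) ≤ 2 * (C * measurementBudget B K S.Q zstar ε)) := by
  refine ⟨budgetConst δ, by linarith [two_le_budgetConst hδ0 hδ1], ?_, ?_⟩
  · intro m K hK Q r zstar B ε Ω _ μ _ X hQ hz hB hε hεQ hX hind hXB hXQ hXr
    exact estimateIsGood_of_samples hδ0 hδ1 hK hQ hz hB hε hεQ hX hind hXB hXQ hXr
  · intro n m K S zstar B ε Ω _ μ _ y hQ hz hB hε hεQ hind hlaw hQB hrB
    have := neZero_of_le_specNorm_mul hε hεQ
    have hy : ∀ q, AEMeasurable (y q) μ := fun q => (hlaw q.1 q.2).aemeasurable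
    refine estimateIsGood_of_samples (X := S.samples y) hδ0 hδ1 (S.one_le_of_posDef hQ) hQ hz hB
      hε hεQ (S.aemeasurable_samples hy) (S.iIndepFun_samples hy hind) ?_
      (fun s i j => S.integral_sampleQ (hlaw s) i j) (fun s i => S.integral_sampleR (hlaw s) i)
    rintro ⟨s, ⟨i, j⟩ | i⟩
    · exact hQB s i j
    · exact hrB s i
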